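/- Let $\mathtt{Vars}$ be a countable set of program variables, let $\Sigma=\{\sigma\colon\mathtt{Vars}\to\mathbb R\}$ be the set of program states with the product $\sigma$-algebra, and let $C$ be a program of the probabilistic guarded command language (skip, assignments, random assignments from a distribution on $\mathbb R$, sequential composition, probabilistic choice, conditionals and possibly nested while-loops, all expressions and guards being measurable). Let $\varphi'\subseteq\Sigma$ be a measurable guard. For $\sigma\in\Sigma$ let $\mathbb P_\sigma$ be the probability measure on infinite traces $s=\sigma_0\sigma_1\sigma_2\cdots$ over $\Sigma\cup\{\uparrow\}$ obtained by iterating the body $C$ forever from $\sigma_0=\sigma$, where $\uparrow$ is an absorbing sink that is entered when an execution of $C$ diverges. Let $X_n(s)=\sigma_n$, let $T=\inf\{n\in\mathbb N\mid X_n\in\Sigma\setminus\varphi'\}\in\mathbb N\cup\{\infty\}$ be the looping time of $\mathtt{while}(\varphi')\{C\}$, and let $X_n^{T}=X_{\min(n,T)}$ be the stopped process. **Theorem (Orthogonal Sufficient Criterion for Uniform Integrability).** Suppose there are $N\in\mathbb N$ and $p\in(0,1)$ such that $\mathbb P_\sigma(T>N)\le p$ for every $\sigma\in\Sigma$. Let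 $h\colon\Sigma\to[0,\infty]$ be a measurable expectation with $h(\sigma)<\infty$ for all $\sigma\in\Sigma$. Suppose further that (i) (bounded update property) there is $c\in\mathbb R_{\ge0}$ such that for every $\sigma\in\Sigma$, $\mathbb P_\sigma(\forall n\in\mathbb N\colon |X_{n+1}-X_n|\le c)=1$, where $|X_{n+1}-X_n|\le c$ means that every variable changes by at most $c$, and is imposed only when $X_n$ and $X_{n+1}$ are both different from $\uparrow$; and (ii) $h\le g$ pointwise on $\Sigma$ for some $g\colon\Sigma\to\mathbb R_{\ge 0}$ that is a polynomial in finitely many program variables, or, more generally, a piecewise polynomial (a polynomial on each piece of a finite measurable partition of $\Sigma$). Then $h$ is uniformly integrable for $\mathtt{while}(\varphi')\{C\}$, that is, for every initial state $\sigma\in\Sigma$ (with the convention $h(\uparrow)=0$), $$\lim_{R\to\infty}\ \sup_{n\in\mathbb N}\ \mathbb E_\sigma\!\left[h(X_n^{T})\cdot\mathbb 1_{h(X_n^{T})\ge R}\right]=0 .$$ -/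

import Mathlib

open MeasureTheory ProbabilityTheory Filter Topology
open scoped ENNReal NNReal

noncomputable section

/-! ### States and outcomes -/

/-- A program state assigns a real value to every program variable; the space of states carries the
product `σ`-algebra. -/
abbrev PState (V : Type*) : Type _ := V → ℝ

/-- A state, or the sink `↑ = Sum.inr ()` that stands for divergence. -/
abbrev Outcome (V : Type*) : Type _ := PState V ⊕ Unit

/-- Stochastic semantics of a program: `κ σ {Sum.inl τ | τ ∈ A}` is the probability that the program
started in `σ` terminates in a state of `A`, and `κ σ {Sum.inr ()}` the probability that it diverges.
The restriction of `κ σ` to the proper states is the subprobability measure over final states. -/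
abbrev Semantics (V : Type*) : Type _ :=
  {κ : Kernel (PState V) (Outcome V) // IsMarkovKernel κ}

/-! ### Syntax of probabilistic programs -/

/-- Programs of the probabilistic guarded command language. Expressions and guards are arbitrary
measurable functions and predicates on states. The bias of a probabilistic choice may depend on
the state (a constant bias is a special case). -/
inductive PGCL (V : Type*) : Type _
  | skip : PGCL V
  | assign (x : V) (e : PState V → ℝ) (he : Measurable e) : PGCL V
  | sample (x : V) (μ : ProbabilityMeasure ℝ) : PGCL V
  | seq (C₁ C₂ : PGCL V) : PGCL V
  | choice (C₁ : PGCL V) (p : PState V → unitInterval) (hp : Measurable p) (C₂ : PGCL V) : PGCL V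
  | ite (φ : Set (PState V)) (hφ : MeasurableSet φ) (C₁ C₂ : PGCL V) : PGCL V
  | loop (φ : Set (PState V)) (hφ : MeasurableSet φ) (C : PGCL V) : PGCL V

/-! ### Traces of iterating a loop body -/

/-- One step of the divergent loop `while (true) {C}` on outcomes: a proper state moves according to
the semantics of the body, the sink `↑` is absorbing. -/
def Semantics.step {V : Type*} (κ : Semantics V) : Kernel (Outcome V) (Outcome V) where
  toFun := Sum.elim κ.1 (fun _ => Measure.dirac (Sum.inr ()))
  measurable' := measurable_fun_sum κ.1.measurable measurable_const

instance Semantics.isMarkovKernel_step {V : Type*} (κ : Semantics V) :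
    IsMarkovKernel κ.step where
  isProbabilityMeasure a := by
    have := κ.2
    rcases a with σ | u
    · exact κ.2.isProbabilityMeasure σ
    · exact Measure.dirac.isProbabilityMeasure

/-- The law on infinite traces `σ₀ σ₁ σ₂ ⋯` of `while (true) {C}`, where `κ` is the semantics of `C`,
as a kernel in the initial state: `σ₀` is the initial state and `σₙ₊₁` is drawn from
`κ.step σₙ`. -/
def Semantics.traceKernel {V : Type*} (κ : Semantics V) :
    Kernel (PState V) (ℕ → Outcome V) :=
  (Kernel.traj (X := fun _ : ℕ => Outcome V)
    (fun n => κ.step.comap (fun x : (i : Finset.Iic n) → Outcome V => x ⟨n, by simp⟩)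
      (measurable_pi_apply _)) 0).comap
    (fun σ _ => Sum.inl σ) (measurable_pi_lambda _ fun _ => measurable_inl)

instance Semantics.isMarkovKernel_traceKernel {V : Type*} (κ : Semantics V) :
    IsMarkovKernel κ.traceKernel := by
  unfold Semantics.traceKernel; infer_instance

/-- `X n s` is the outcome after the `n`-th iteration of the loop body. -/
def traceX {V : Type*} (n : ℕ) (s : ℕ → Outcome V) : Outcome V := s n

/-- The looping time of a loop with guard `φ`: the first `n` such that the outcome after `n`
iterations is a (proper) state violating `φ`, and `⊤` if there is none. -/
def loopingTime {V : Type*} (φ : Set (PState V)) : (ℕ → Outcome V) → WithTop ℕ :=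
  hittingAfter traceX (Sum.inl '' φᶜ) 0

/-- The outcome of a loop with guard `φ` along a trace of its body: the state at the looping time,
or `↑` if the looping time is infinite. -/
def loopOutcome {V : Type*} (φ : Set (PState V)) (s : ℕ → Outcome V) : Outcome V :=
  if loopingTime φ s = ⊤ then Sum.inr () else stoppedValue traceX (loopingTime φ) s

lemma measurable_loopingTime {V : Type*} {φ : Set (PState V)} (hφ : MeasurableSet φ) (t : WithTop ℕ) :
    MeasurableSet {s | loopingTime φ s = t} := by
  have hA : MeasurableSet (Sum.inl '' φᶜ : Set (Outcome V)) :=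
    hφ.compl.inl_image
  have hlt : ∀ n : ℕ, MeasurableSet {s | loopingTime φ s < WithTop.some n} := by
    intro n
    have : {s | loopingTime φ s < WithTop.some n} =
        ⋃ j ∈ Set.Iio n, (fun s : ℕ → Outcome V => s j) ⁻¹' (Sum.inl '' φᶜ) := by
      ext s
      refine hittingAfter_lt_iff.trans ?_
      simp [traceX]
    rw [this]
    exact MeasurableSet.biUnion (Set.to_countable _) fun j _ => measurable_pi_apply j hA
  have htop : MeasurableSet {s | loopingTime φ s = ⊤} := by
    have : {s | loopingTime φ s = ⊤} = (⋃ n : ℕ, {s | loopingTime φ s < WithTop.some n})ᶜ := by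
      ext s
      simp only [Set.mem_ofPred_eq, Set.mem_compl_iff, Set.mem_iUnion, not_exists, not_lt]
      constructor
      · intro h n; rw [h]; exact le_top
      · intro h
        induction ht : loopingTime φ s with
        | top => rfl
        | coe k =>
          have := h (k + 1)
          rw [ht] at this
          exact absurd (WithTop.coe_le_coe.1 this) (by simp)
    rw [this]
    exact (MeasurableSet.iUnion hlt).compl
  induction t with
  | top => exact htop
  | coe n =>
    have : {s | loopingTime φ s = WithTop.some n} =
        {s | loopingTime φ s < WithTop.some (n + 1)} \
          {s | loopingTime φ s < WithTop.some n} := by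
      ext s
      simp only [Set.mem_ofPred_eq, Set.mem_sdiff, not_lt]
      induction loopingTime φ s with
      | top => simp
      | coe k =>
        simp only [WithTop.coe_lt_coe, WithTop.coe_le_coe, WithTop.coe_inj]
        omega
    rw [this]
    exact (hlt _).diff (hlt _)

lemma measurable_loopOutcome {V : Type*} {φ : Set (PState V)} (hφ : MeasurableSet φ) :
    Measurable (loopOutcome φ) := by
  intro A hA
  have : loopOutcome φ ⁻¹' A = ⋃ t : WithTop ℕ, ({s | loopingTime φ s = t} ∩
      {s | (if t = ⊤ then Sum.inr () else s t.untopA) ∈ A}) := by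
    ext s
    simp [loopOutcome, stoppedValue, traceX]
  rw [this]
  have : Countable (WithTop ℕ) := inferInstanceAs (Countable (Option ℕ))
  refine MeasurableSet.iUnion fun t => (measurable_loopingTime hφ t).inter ?_
  split_ifs
  · exact measurable_const hA
  · exact measurable_pi_apply _ hA

/-! ### Semantics of programs -/

open scoped Classical in
lemma measurable_updateState {V : Type*} (x : V) :
    Measurable (fun q : PState V × ℝ => (Sum.inl (Function.update q.1 x q.2) : Outcome V)) := by
  refine measurable_inl.comp (measurable_pi_lambda _ fun y => ?_)
  by_cases h : y = x
  · subst h; simpa using measurable_snd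
  · simpa [Function.update_of_ne h] using measurable_fst.eval

/-- `p(σ) · κ(σ) + (1 - p(σ)) · η(σ)`. -/
def Semantics.choice {V : Type*} (p : PState V → unitInterval) (hp : Measurable p)
    (κ η : Semantics V) : Semantics V where
  val :=
    { toFun := fun σ => ENNReal.ofReal (p σ) • κ.1 σ + ENNReal.ofReal (1 - p σ) • η.1 σ
      measurable' := by
        refine Measure.measurable_of_measurable_coe _ fun A hA => ?_
        have hp' : Measurable fun σ => (p σ : ℝ) := measurable_subtype_coe.comp hp
        simp only [Measure.coe_add, Measure.coe_smul, Pi.add_apply, Pi.smul_apply, smul_eq_mul]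
        exact (hp'.ennreal_ofReal.mul (κ.1.measurable_coe hA)).add
          ((measurable_const.sub hp').ennreal_ofReal.mul (η.1.measurable_coe hA)) }
  property := ⟨fun σ => ⟨by
    have := κ.2
    have := η.2
    change (ENNReal.ofReal (p σ) • κ.1 σ + ENNReal.ofReal (1 - p σ) • η.1 σ) Set.univ = 1
    simp only [Measure.coe_add, Measure.coe_smul, Pi.add_apply, Pi.smul_apply, smul_eq_mul,
      measure_univ, mul_one]
    rw [← ENNReal.ofReal_add (p σ).2.1 (by linarith [(p σ).2.2])]
    simp⟩⟩

open scoped Classical in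
/-- The semantics of a program. A loop iterates its body and returns the first state that violates
the guard; it diverges if there is none. -/
def PGCL.sem {V : Type*} : PGCL V → Semantics V
  | .skip => ⟨Kernel.deterministic Sum.inl measurable_inl, inferInstance⟩
  | .assign x e he =>
      ⟨Kernel.deterministic (fun σ => Sum.inl (Function.update σ x (e σ)))
        ((measurable_updateState x).comp (measurable_id.prodMk he)), inferInstance⟩
  | .sample x μ =>
      ⟨(Kernel.id ×ₖ Kernel.const (PState V) (μ : Measure ℝ)).map
          (fun q : PState V × ℝ => (Sum.inl (Function.update q.1 x q.2) : Outcome V)),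
        Kernel.IsMarkovKernel.map _ (measurable_updateState x)⟩
  | .seq C₁ C₂ =>
      ⟨C₂.sem.step ∘ₖ C₁.sem.1, by have := C₁.sem.2; infer_instance⟩
  | .choice C₁ p hp C₂ => Semantics.choice p hp C₁.sem C₂.sem
  | .ite _ hφ C₁ C₂ =>
      ⟨Kernel.piecewise hφ C₁.sem.1 C₂.sem.1, by
        have := C₁.sem.2; have := C₂.sem.2; infer_instance⟩
  | .loop φ hφ C =>
      ⟨C.sem.traceKernel.map (loopOutcome φ),
        Kernel.IsMarkovKernel.map _ (measurable_loopOutcome hφ)⟩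

/-- The probability measure on infinite traces induced by iterating the loop body `C` from the
initial state `σ`. -/
def traceMeasure {V : Type*} (C : PGCL V) (σ : PState V) : Measure (ℕ → Outcome V) :=
  C.sem.traceKernel σ

/-! ### Conditions on the loop `while (φ) {C}` -/

/-- There are `N` and `p ∈ (0,1)` such that from every initial state the looping time exceeds `N`
with probability at most `p`. -/
def ASTWitness {V : Type*} (φ : Set (PState V)) (C : PGCL V) : Prop :=
  ∃ N : ℕ, ∃ p : ℝ, 0 < p ∧ p < 1 ∧ ∀ σ : PState V,
    traceMeasure C σ {s | WithTop.some N < loopingTime φ s} ≤ ENNReal.ofReal p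

/-- Two consecutive outcomes differ by at most `c` in every variable. Only pairs of proper states
are constrained. -/
def UpdateBoundedBy {V : Type*} (c : ℝ≥0) (o o' : Outcome V) : Prop :=
  ∀ σ τ : PState V, o = Sum.inl σ → o' = Sum.inl τ → ∀ x, |τ x - σ x| ≤ c

/-- The bounded update property. -/
def BoundedUpdate {V : Type*} (C : PGCL V) : Prop :=
  ∃ c : ℝ≥0, ∀ σ : PState V,
    ∀ᵐ s ∂(traceMeasure C σ), ∀ n, UpdateBoundedBy c (traceX n s) (traceX (n + 1) s)

/-! ### Expectations -/

/-- `g` is given by a polynomial in the program variables that is nonnegative on all states. -/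
def IsPolynomialExpectation {V : Type*} (g : PState V → ℝ≥0∞) : Prop :=
  ∃ q : MvPolynomial V ℝ, ∀ σ, 0 ≤ MvPolynomial.eval σ q ∧
    g σ = ENNReal.ofReal (MvPolynomial.eval σ q)

/-- The state space is split into finitely many measurable pieces, and on each of them `g` is given
by a polynomial in the program variables that is nonnegative there. -/
def IsPiecewisePolynomialExpectation {V : Type*} (g : PState V → ℝ≥0∞) : Prop :=
  ∃ (k : ℕ) (piece : PState V → Fin k) (q : Fin k → MvPolynomial V ℝ), Measurable piece ∧
    ∀ σ, 0 ≤ MvPolynomial.eval σ (q (piece σ)) ∧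
      g σ = ENNReal.ofReal (MvPolynomial.eval σ (q (piece σ)))

/-- An expectation evaluated at an outcome; the sink `↑` contributes `0`. -/
def evalOutcome {V : Type*} (h : PState V → ℝ≥0∞) : Outcome V → ℝ≥0∞ :=
  Sum.elim h (fun _ => 0)

/-! ### Uniform integrability -/

/-- Uniform integrability of a nonnegative stochastic process:
`lim_{R → ∞} sup_n E[Yₙ · 1_{Yₙ ≥ R}] = 0`. -/
def UniformlyIntegrableSeq {Ω : Type*} [MeasurableSpace Ω] (P : Measure Ω)
    (Y : ℕ → Ω → ℝ≥0∞) : Prop :=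
  (∀ n, Measurable (Y n)) ∧
    Tendsto (fun R : ℝ≥0 => ⨆ n, ∫⁻ ω, {ω | (R : ℝ≥0∞) ≤ Y n ω}.indicator (Y n) ω ∂P)
      atTop (𝓝 0)

/-- `h` is uniformly integrable for `while (φ) {C}`: from every initial state, the expectation `h`
along the trace stopped at the looping time is uniformly integrable. -/
def UniformlyIntegrableFor {V : Type*} (φ : Set (PState V)) (C : PGCL V)
    (h : PState V → ℝ≥0∞) : Prop :=
  ∀ σ : PState V, UniformlyIntegrableSeq (traceMeasure C σ)
    (fun n s => evalOutcome h (stoppedProcess traceX (loopingTime φ) n s))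

end

/-!
The proof dominates the whole stopped process by a single integrable random variable.

Let `survivalSet φ n` be the event that the trace is in proper states satisfying the guard at all
times `0, …, n`. Since a surviving trace has looping time greater than `n`, the hypothesis on the
looping time bounds the probability of surviving up to time `N + 1` by `p`, uniformly in the initial
state. By the Markov property of the trace measure (`Semantics.lintegral_traceKernel_succ`), each
further period of length `N + 1` costs another factor `p`, so survival up to time `n` has probability
at most `p ^ (n / (N + 1))` (`survivalSet_le_pow_div`). The sink has to be excluded from survival:
a body that diverges with positive probability makes the looping time infinite with positive
probability, and the tail of the looping time itself then does not decay. This does no harm, because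
expectations vanish at the sink and, almost surely, a trace never leaves it.

By the bounded update property, a trace that has run through proper states for `m` iterations has
moved by at most `c * m` in every variable, so a piecewise polynomial is at most `K * (1 + m) ^ d`
there, with `K` and `d` depending on the initial state
(`IsPiecewisePolynomialExpectation.exists_le_of_linear_growth`). Such a trace also survives up to
time `m - 1` if it is not stopped earlier. Hence the stopped process is at most
`survivalDominator φ b` for `b m = K * (1 + m) ^ d` (`evalOutcome_stoppedProcess_le`), whose
integral is a series of polynomial terms times geometrically decaying ones
(`summable_polynomial_mul_pow_div`). An integrable dominating function gives uniform integrability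
(`UniformlyIntegrableSeq.of_ae_le`).
-/

/-! ### The Markov property of the trace measure -/

section Markov

variable {V : Type*} (κ : Semantics V) (σ : PState V)

/-- Countability of the variables makes the singleton of the initial state measurable. -/
lemma Semantics.ae_traceKernel_zero [Countable V] : ∀ᵐ s ∂κ.traceKernel σ, s 0 = Sum.inl σ := by
  have h := Kernel.traj_map_frestrictLe_apply (X := fun _ : ℕ => Outcome V)
    (κ := fun n => κ.step.comap (fun x : (i : Finset.Iic n) → Outcome V => x ⟨n, by simp⟩)
      (measurable_pi_apply _)) 0 0 (fun _ => Sum.inl σ)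
  rw [Kernel.partialTraj_self, Kernel.id_apply] at h
  have hσ : MeasurableSet {x : (i : Finset.Iic 0) → Outcome V | x ⟨0, by simp⟩ = Sum.inl σ} := by
    have h1 : MeasurableSet (Sum.inl '' {σ} : Set (Outcome V)) :=
      (measurableSet_singleton σ).inl_image
    rw [Set.image_singleton] at h1
    exact (measurable_pi_apply (X := fun _ => Outcome V) (⟨0, by simp⟩ : Finset.Iic 0)) h1
  have hd : ∀ᵐ x ∂Measure.dirac (fun _ : Finset.Iic 0 => (Sum.inl σ : Outcome V)),
      x ⟨0, by simp⟩ = Sum.inl σ := (ae_dirac_iff hσ).2 rfl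
  rw [← h] at hd
  exact ae_of_ae_map (Preorder.measurable_frestrictLe 0).aemeasurable hd

/-- The Markov property at time `n`: given the trace up to time `n`, the next outcome is drawn from
one step of the loop body started at the current outcome. -/
lemma Semantics.lintegral_traceKernel_succ (n : ℕ)
    {f : ((i : Finset.Iic n) → Outcome V) × Outcome V → ℝ≥0∞} (hf : Measurable f) :
    ∫⁻ s, f (Preorder.frestrictLe n s, s (n + 1)) ∂κ.traceKernel σ =
      ∫⁻ s, ∫⁻ y, f (Preorder.frestrictLe n s, y) ∂κ.step (s n) ∂κ.traceKernel σ := by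
  let η : (n : ℕ) → Kernel ((i : Finset.Iic n) → Outcome V) (Outcome V) :=
    fun n => κ.step.comap (fun x : (i : Finset.Iic n) → Outcome V => x ⟨n, by simp⟩)
      (measurable_pi_apply _)
  have h := Kernel.partialTraj_compProd_eq_map_traj (X := fun _ : ℕ => Outcome V)
    (κ := η) (Nat.zero_le n) (x₀ := fun _ => Sum.inl σ)
  have hm : Measurable fun s : ℕ → Outcome V =>
      (Preorder.frestrictLe (π := fun _ : ℕ => Outcome V) n s, s (n + 1)) := by fun_prop
  change ∫⁻ s, f (Preorder.frestrictLe n s, s (n + 1))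
      ∂Kernel.traj (X := fun _ : ℕ => Outcome V) η 0 (fun _ => Sum.inl σ) =
    ∫⁻ s, ∫⁻ y, f (Preorder.frestrictLe n s, y) ∂κ.step (s n)
      ∂Kernel.traj (X := fun _ : ℕ => Outcome V) η 0 (fun _ => Sum.inl σ)
  rw [← lintegral_map hf hm, ← h, Measure.lintegral_compProd hf,
    ← Kernel.traj_map_frestrictLe_apply, lintegral_map _ (by fun_prop)]
  · rfl
  · exact Measurable.lintegral_kernel_prod_right hf

/-- Almost surely, a trace that has entered the sink stays there. -/
lemma Semantics.ae_traceKernel_absorbing :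
    ∀ᵐ s ∂κ.traceKernel σ, ∀ n, s n = Sum.inr () → s (n + 1) = Sum.inr () := by
  refine ae_all_iff.2 fun n => ?_
  have hr : Measurable ((Set.range Sum.inr).indicator 1 : Outcome V → ℝ≥0∞) :=
    measurable_one.indicator measurableSet_range_inr
  have hl : Measurable ((Set.range Sum.inl).indicator 1 : Outcome V → ℝ≥0∞) :=
    measurable_one.indicator measurableSet_range_inl
  have h := κ.lintegral_traceKernel_succ σ n
    (f := fun x => (Set.range Sum.inr).indicator 1 (x.1 ⟨n, by simp⟩) *
      (Set.range Sum.inl).indicator 1 x.2)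
    ((hr.comp ((measurable_pi_apply _).comp measurable_fst)).mul (hl.comp measurable_snd))
  have h0 : ∀ s : ℕ → Outcome V, ∫⁻ y, (Set.range Sum.inr).indicator 1 (s n) *
      (Set.range Sum.inl).indicator 1 y ∂κ.step (s n) = 0 := by
    intro s
    rw [lintegral_const_mul _ hl]
    rcases hs : s n with τ | u
    · simp
    · have : κ.step (Sum.inr u) = Measure.dirac (Sum.inr ()) := rfl
      rw [this, lintegral_dirac' _ hl]
      simp
  simp only [Preorder.frestrictLe_apply, h0, lintegral_zero] at h
  have h' := (lintegral_eq_zero_iff ((hr.comp (measurable_pi_apply n)).mul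
    (hl.comp (measurable_pi_apply (n + 1))))).1 h
  filter_upwards [h'] with s hs hn
  rcases hs' : s (n + 1) with τ | u
  · simp [hn, hs'] at hs
  · rfl

end Markov

/-! ### Geometric decay of the survival probabilities -/

section Survival

variable {V : Type*}

/-- The traces that are in proper states satisfying the guard at all times up to `n`. A trace that
has entered the sink does not count as surviving, although its looping time is infinite. -/
def survivalSet (φ : Set (PState V)) (n : ℕ) : Set (ℕ → Outcome V) :=
  {s | ∀ j ≤ n, s j ∈ Sum.inl '' φ}

lemma measurableSet_survivalSet {φ : Set (PState V)} (hφ : MeasurableSet φ) (n : ℕ) :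
    MeasurableSet (survivalSet φ n) := by
  have : survivalSet φ n = ⋂ j ∈ Set.Iic n, (fun s => s j) ⁻¹' (Sum.inl '' φ) := by
    ext s; simp [survivalSet]
  rw [this]
  exact MeasurableSet.biInter (Set.to_countable _) fun j _ =>
    measurable_pi_apply j hφ.inl_image

lemma survivalSet_anti (φ : Set (PState V)) : Antitone (survivalSet φ) :=
  fun _ _ hmn _ hs j hj => hs j (hj.trans hmn)

lemma survivalSet_succ (φ : Set (PState V)) (n : ℕ) :
    survivalSet φ (n + 1) = survivalSet φ n ∩ {s | s (n + 1) ∈ Sum.inl '' φ} := by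
  ext s
  simp only [survivalSet, Set.mem_ofPred_eq, Set.mem_inter_iff]
  constructor
  · exact fun h => ⟨fun j hj => h j (by omega), h _ le_rfl⟩
  · rintro ⟨h, h'⟩ j hj
    rcases Nat.le_succ_iff.1 hj with hj | rfl
    exacts [h j hj, h']

lemma survivalSet_subset_lt_loopingTime (φ : Set (PState V)) (n : ℕ) :
    survivalSet φ n ⊆ {s | WithTop.some n < loopingTime φ s} := by
  intro s hs
  by_contra hlt
  have hlt' : loopingTime φ s < WithTop.some (n + 1) := by
    refine (not_lt.1 hlt).trans_lt ?_
    exact WithTop.coe_lt_coe.2 n.lt_succ_self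
  obtain ⟨j, hj, hjs⟩ := hittingAfter_lt_iff.1 hlt'
  obtain ⟨τ, hτ, hτs⟩ := hs j (by simpa [Nat.lt_succ_iff] using hj.2)
  obtain ⟨τ', hτ', hτs'⟩ := hjs
  have : τ = τ' := Sum.inl_injective (hτs.trans hτs'.symm)
  exact hτ' (this ▸ hτ)

/-- The probability that the chain started in a given outcome stays in proper states satisfying the
guard up to time `k`, defined by first-step recursion. -/
noncomputable def survivalProb (κ : Semantics V) (φ : Set (PState V)) : ℕ → Outcome V → ℝ≥0∞
  | 0 => (Sum.inl '' φ).indicator 1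
  | k + 1 => (Sum.inl '' φ).indicator fun o => ∫⁻ y, survivalProb κ φ k y ∂κ.step o

variable (κ : Semantics V) {φ : Set (PState V)}

lemma measurable_survivalProb (hφ : MeasurableSet φ) (k : ℕ) : Measurable (survivalProb κ φ k) := by
  induction k with
  | zero => exact measurable_one.indicator hφ.inl_image
  | succ k ih => exact (ih.lintegral_kernel (κ := κ.step)).indicator hφ.inl_image

lemma survivalProb_eq_zero {k : ℕ} {o : Outcome V} (ho : o ∉ Sum.inl '' φ) :
    survivalProb κ φ k o = 0 := by
  cases k <;> exact Set.indicator_of_notMem ho _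

/-- Surviving up to time `n + k` means surviving up to time `n` and then for `k` more steps from the
outcome reached. The induction on `k` peels off one step by the Markov property at time `n`. -/
lemma setLIntegral_survivalProb (hφ : MeasurableSet φ) (σ : PState V) (n k : ℕ) :
    ∫⁻ s in survivalSet φ n, survivalProb κ φ k (s n) ∂κ.traceKernel σ =
      κ.traceKernel σ (survivalSet φ (n + k)) := by
  induction k generalizing n with
  | zero =>
    rw [setLIntegral_congr_fun (measurableSet_survivalSet hφ n) (g := 1) fun s hs =>
      Set.indicator_of_mem (hs n le_rfl) _]
    simp
  | succ k ih =>
    have hB : MeasurableSet {x : (i : Finset.Iic n) → Outcome V | ∀ i, x i ∈ Sum.inl '' φ} := by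
      have : {x : (i : Finset.Iic n) → Outcome V | ∀ i, x i ∈ Sum.inl '' φ} =
          ⋂ i, (fun x => x i) ⁻¹' (Sum.inl '' φ) := by ext; simp
      rw [this]
      exact MeasurableSet.iInter fun i => measurable_pi_apply i hφ.inl_image
    have hS : ∀ s : ℕ → Outcome V, s ∈ survivalSet φ n ↔
        Preorder.frestrictLe (π := fun _ => Outcome V) n s ∈
          {x : (i : Finset.Iic n) → Outcome V | ∀ i, x i ∈ Sum.inl '' φ} := by
      intro s; simp [survivalSet]
    have hu := measurable_survivalProb κ hφ k
    have hm := κ.lintegral_traceKernel_succ σ n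
      (f := fun x => {x : (i : Finset.Iic n) → Outcome V |
        ∀ i, x i ∈ Sum.inl '' φ}.indicator 1 x.1 * survivalProb κ φ k x.2)
      (((measurable_one.indicator hB).comp measurable_fst).mul (hu.comp measurable_snd))
    have hmS := measurableSet_survivalSet hφ n
    rw [show n + (k + 1) = n + 1 + k by omega, ← ih (n + 1),
      ← lintegral_indicator hmS, ← lintegral_indicator (measurableSet_survivalSet hφ (n + 1))]
    trans ∫⁻ s, ∫⁻ y, {x : (i : Finset.Iic n) → Outcome V | ∀ i, x i ∈ Sum.inl '' φ}.indicator 1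
        (Preorder.frestrictLe (π := fun _ => Outcome V) n s) * survivalProb κ φ k y
        ∂κ.step (s n) ∂κ.traceKernel σ
    · refine lintegral_congr fun s => ?_
      rw [lintegral_const_mul _ hu]
      by_cases hs : s ∈ survivalSet φ n
      · rw [Set.indicator_of_mem hs, Set.indicator_of_mem ((hS s).1 hs), survivalProb,
          Set.indicator_of_mem (hs n le_rfl)]
        simp
      · rw [Set.indicator_of_notMem hs, Set.indicator_of_notMem (mt (hS s).2 hs), zero_mul]
    · rw [← hm]
      refine lintegral_congr fun s => ?_
      dsimp only
      by_cases hs : s ∈ survivalSet φ n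
      · rw [Set.indicator_of_mem ((hS s).1 hs), Pi.one_apply, one_mul]
        by_cases hs' : s (n + 1) ∈ Sum.inl '' φ
        · rw [Set.indicator_of_mem]
          rw [survivalSet_succ]; exact ⟨hs, hs'⟩
        · rw [survivalProb_eq_zero κ hs', Set.indicator_of_notMem]
          exact fun h => hs' (h _ le_rfl)
      · rw [Set.indicator_of_notMem (mt (hS s).2 hs), zero_mul, Set.indicator_of_notMem]
        exact fun h => hs (survivalSet_anti φ n.le_succ h)

lemma survivalProb_inl [Countable V] (hφ : MeasurableSet φ) (k : ℕ) (σ : PState V) :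
    survivalProb κ φ k (Sum.inl σ) = κ.traceKernel σ (survivalSet φ k) := by
  have h := setLIntegral_survivalProb κ hφ σ 0 k
  rw [zero_add] at h
  rw [← h, ← lintegral_indicator (measurableSet_survivalSet hφ 0)]
  have : ∀ᵐ s ∂κ.traceKernel σ,
      (survivalSet φ 0).indicator (fun s => survivalProb κ φ k (s 0)) s =
        survivalProb κ φ k (Sum.inl σ) := by
    filter_upwards [κ.ae_traceKernel_zero σ] with s hs
    by_cases hs' : s ∈ survivalSet φ 0
    · rw [Set.indicator_of_mem hs', hs]
    · rw [Set.indicator_of_notMem hs', survivalProb_eq_zero]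
      intro hσ
      exact hs' fun j hj => by rwa [Nat.le_zero.1 hj, hs]
  rw [lintegral_congr_ae this]
  simp

lemma survivalSet_add_le [Countable V] (hφ : MeasurableSet φ) {N : ℕ} {p : ℝ≥0∞}
    (hp : ∀ τ, κ.traceKernel τ (survivalSet φ N) ≤ p) (σ : PState V) (n : ℕ) :
    κ.traceKernel σ (survivalSet φ (n + N)) ≤ p * κ.traceKernel σ (survivalSet φ n) := by
  rw [← setLIntegral_survivalProb κ hφ]
  refine (setLIntegral_mono measurable_const (g := fun _ => p) fun s hs => ?_).trans ?_
  · obtain ⟨τ, -, hτ⟩ := hs n le_rfl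
    rw [← hτ, survivalProb_inl κ hφ]
    exact hp τ
  · simp

/-- Valid also for `N = 0`, where `n / 0 = 0` makes the bound trivial. -/
lemma survivalSet_le_pow_div [Countable V] (hφ : MeasurableSet φ) {N : ℕ} {p : ℝ≥0∞}
    (hp : ∀ τ, κ.traceKernel τ (survivalSet φ N) ≤ p) (σ : PState V) (n : ℕ) :
    κ.traceKernel σ (survivalSet φ n) ≤ p ^ (n / N) := by
  have key : ∀ k, κ.traceKernel σ (survivalSet φ (N * k)) ≤ p ^ k := by
    intro k
    induction k with
    | zero => simpa using prob_le_one
    | succ k ih =>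
      rw [Nat.mul_succ, pow_succ']
      exact (survivalSet_add_le κ hφ hp σ _).trans (by gcongr)
  exact (measure_mono (survivalSet_anti φ (Nat.mul_div_le n N))).trans (key _)

end Survival

/-! ### Polynomial growth along bounded updates -/

section Growth

variable {V : Type*}

lemma MvPolynomial.exists_abs_eval_le_of_linear_growth (c : ℝ≥0) (σ : PState V)
    (q : MvPolynomial V ℝ) :
    ∃ (K : ℝ) (d : ℕ), 0 ≤ K ∧ ∀ (n : ℕ) (τ : PState V), (∀ x, |τ x - σ x| ≤ c * n) →
      |MvPolynomial.eval τ q| ≤ K * (1 + n) ^ d := by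
  induction q using MvPolynomial.induction_on with
  | C a => exact ⟨|a|, 0, abs_nonneg a, by simp⟩
  | add q₁ q₂ h₁ h₂ =>
    obtain ⟨K₁, d₁, hK₁, h₁⟩ := h₁
    obtain ⟨K₂, d₂, hK₂, h₂⟩ := h₂
    refine ⟨K₁ + K₂, d₁ + d₂, by positivity, fun n τ hτ => ?_⟩
    have hn : (1 : ℝ) ≤ 1 + n := by simp
    rw [map_add, add_mul]
    refine (abs_add_le _ _).trans (add_le_add ((h₁ n τ hτ).trans ?_) ((h₂ n τ hτ).trans ?_))
    · gcongr; omega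
    · gcongr; omega
  | mul_X q x h =>
    obtain ⟨K, d, hK, h⟩ := h
    refine ⟨K * (|σ x| + c), d + 1, by positivity, fun n τ hτ => ?_⟩
    have hx : |τ x| ≤ (|σ x| + c) * (1 + n) := by
      have h1 : |τ x| ≤ |τ x - σ x| + |σ x| := by
        simpa using abs_add_le (τ x - σ x) (σ x)
      have h2 : 0 ≤ |σ x| * n := by positivity
      nlinarith [hτ x, c.coe_nonneg]
    rw [map_mul, MvPolynomial.eval_X, abs_mul]
    calc |MvPolynomial.eval τ q| * |τ x| ≤ (K * (1 + n) ^ d) * ((|σ x| + c) * (1 + n)) :=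
          mul_le_mul (h n τ hτ) hx (abs_nonneg _) (by positivity)
      _ = K * (|σ x| + c) * (1 + n) ^ (d + 1) := by ring

lemma IsPolynomialExpectation.isPiecewisePolynomialExpectation {g : PState V → ℝ≥0∞}
    (hg : IsPolynomialExpectation g) : IsPiecewisePolynomialExpectation g := by
  obtain ⟨q, hq⟩ := hg
  exact ⟨1, fun _ => 0, fun _ => q, measurable_const, hq⟩

lemma IsPiecewisePolynomialExpectation.exists_le_of_linear_growth {g : PState V → ℝ≥0∞}
    (hg : IsPiecewisePolynomialExpectation g) (c : ℝ≥0) (σ : PState V) :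
    ∃ (K : ℝ) (d : ℕ), 0 ≤ K ∧ ∀ (n : ℕ) (τ : PState V), (∀ x, |τ x - σ x| ≤ c * n) →
      g τ ≤ ENNReal.ofReal (K * (1 + n) ^ d) := by
  obtain ⟨k, piece, q, -, hq⟩ := hg
  choose K d hK h using fun i =>
    MvPolynomial.exists_abs_eval_le_of_linear_growth c σ (q i)
  refine ⟨∑ i, K i, ∑ i, d i, Finset.sum_nonneg fun i _ => hK i, fun n τ hτ => ?_⟩
  rw [(hq τ).2]
  refine ENNReal.ofReal_le_ofReal ((le_abs_self _).trans ((h (piece τ) n τ hτ).trans ?_))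
  have h1 : K (piece τ) ≤ ∑ i, K i :=
    Finset.single_le_sum (fun i _ => hK i) (Finset.mem_univ _)
  have h2 : d (piece τ) ≤ ∑ i, d i :=
    Finset.single_le_sum (fun i _ => Nat.zero_le (d i)) (Finset.mem_univ _)
  have hn : (1 : ℝ) ≤ 1 + n := by simp
  exact mul_le_mul h1 (pow_le_pow_right₀ hn h2) (by positivity)
    (Finset.sum_nonneg fun i _ => hK i)

lemma abs_sub_le_of_updateBoundedBy {c : ℝ≥0} {s : ℕ → Outcome V} {σ : PState V}
    (h0 : s 0 = Sum.inl σ) (hs : ∀ n, UpdateBoundedBy c (s n) (s (n + 1))) {n : ℕ}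
    (hproper : ∀ j < n, s j ∈ Set.range Sum.inl) {τ : PState V} (hτ : s n = Sum.inl τ) (x : V) :
    |τ x - σ x| ≤ c * n := by
  induction n generalizing τ with
  | zero =>
    have : τ = σ := Sum.inl_injective (hτ.symm.trans h0)
    simp [this]
  | succ n ih =>
    obtain ⟨ρ, hρ⟩ := hproper n n.lt_succ_self
    have h1 := ih (fun j hj => hproper j (by omega)) hρ.symm
    have h2 := hs n ρ τ hρ.symm hτ x
    have h3 := abs_sub_le (τ x) (ρ x) (σ x)
    push_cast
    linarith

end Growth

/-! ### Uniform integrability by domination -/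

/-- A sequence dominated almost everywhere by one integrable function is uniformly integrable. -/
lemma UniformlyIntegrableSeq.of_ae_le {Ω : Type*} [MeasurableSpace Ω] {P : Measure Ω}
    {Y : ℕ → Ω → ℝ≥0∞} {F : Ω → ℝ≥0∞} (hY : ∀ n, Measurable (Y n)) (hF : Measurable F)
    (hFint : ∫⁻ ω, F ω ∂P ≠ ∞) (hle : ∀ n, ∀ᵐ ω ∂P, Y n ω ≤ F ω) :
    UniformlyIntegrableSeq P Y := by
  refine ⟨hY, ?_⟩
  have hmeas : Tendsto (fun R : ℝ≥0 => P {ω | (R : ℝ≥0∞) ≤ F ω}) atTop (𝓝 0) := by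
    have hdiv : Tendsto (fun R : ℝ≥0 => (∫⁻ ω, F ω ∂P) / (R : ℝ≥0∞)) atTop (𝓝 0) := by
      have := ENNReal.Tendsto.const_div (a := ∫⁻ ω, F ω ∂P) (ENNReal.tendsto_coe_nhds_top.2 tendsto_id)
        (Or.inr hFint)
      simpa using this
    refine tendsto_of_tendsto_of_tendsto_of_le_of_le' tendsto_const_nhds hdiv
      (Eventually.of_forall fun _ => zero_le) ?_
    filter_upwards [eventually_gt_atTop 0] with R hR
    exact meas_ge_le_lintegral_div hF.aemeasurable (by simpa using hR.ne') ENNReal.coe_ne_top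
  refine tendsto_of_tendsto_of_tendsto_of_le_of_le tendsto_const_nhds
    (tendsto_setLIntegral_zero hFint hmeas) (fun _ => zero_le) fun R => iSup_le fun n => ?_
  dsimp only
  rw [← lintegral_indicator (measurableSet_le measurable_const hF)]
  refine lintegral_mono_ae ?_
  filter_upwards [hle n] with ω hω
  by_cases hR : (R : ℝ≥0∞) ≤ Y n ω
  · rw [Set.indicator_of_mem (by exact hR), Set.indicator_of_mem (by exact hR.trans hω)]
    exact hω
  · rw [Set.indicator_of_notMem (by exact hR)]
    exact zero_le

/-- The integer division slows the geometric decay to the ratio `p ^ (1 / (N + 1))`, which is still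
less than `1`. -/
lemma summable_polynomial_mul_pow_div {p : ℝ} (hp0 : 0 < p) (hp1 : p < 1) (K : ℝ) (d N : ℕ) :
    Summable fun j : ℕ => K * (1 + ((j + 1 : ℕ) : ℝ)) ^ d * p ^ (j / (N + 1)) := by
  set r : ℝ := p ^ ((N + 1 : ℝ)⁻¹) with hr
  have hr0 : 0 < r := Real.rpow_pos_of_pos hp0 _
  have hr1 : r < 1 := Real.rpow_lt_one hp0.le hp1 (by positivity)
  have hrN : r ^ (N + 1) = p := by
    rw [hr, ← Nat.cast_succ, Real.rpow_inv_natCast_pow hp0.le (by omega)]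
  have hsum : Summable fun j : ℕ => ((j : ℝ)) ^ d * r ^ j :=
    summable_pow_mul_geometric_of_norm_lt_one d (by rwa [Real.norm_of_nonneg hr0.le])
  have hshift := ((summable_nat_add_iff 2).2 hsum).mul_left (|K| * p⁻¹ * (r ^ 2)⁻¹)
  refine Summable.of_norm_bounded hshift fun j => ?_
  -- `j = (N + 1) * (j / (N + 1)) + j % (N + 1)` and the remainder costs at most a factor `p⁻¹`.
  have hpow : p ^ (j / (N + 1)) ≤ p⁻¹ * r ^ j := by
    rw [← div_eq_inv_mul, le_div_iff₀ hp0]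
    have : p ^ (j / (N + 1)) * p = r ^ ((N + 1) * (j / (N + 1)) + (N + 1)) := by
      rw [pow_add, pow_mul, hrN]
    rw [this]
    refine pow_le_pow_of_le_one hr0.le hr1.le ?_
    have h1 := Nat.div_add_mod j (N + 1)
    have h2 := Nat.mod_lt j (show N + 1 > 0 by omega)
    omega
  rw [norm_mul, norm_mul, Real.norm_eq_abs, Real.norm_of_nonneg (by positivity),
    Real.norm_of_nonneg (by positivity)]
  calc |K| * (1 + ((j + 1 : ℕ) : ℝ)) ^ d * p ^ (j / (N + 1))
      ≤ |K| * (1 + ((j + 1 : ℕ) : ℝ)) ^ d * (p⁻¹ * r ^ j) := by gcongr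
    _ = |K| * p⁻¹ * (r ^ 2)⁻¹ * (((j + 2 : ℕ) : ℝ) ^ d * r ^ (j + 2)) := by
      push_cast
      field_simp
      ring

/-! ### The stopped process -/

section Stopped

variable {V : Type*} {φ : Set (PState V)}

lemma measurable_evalOutcome {h : PState V → ℝ≥0∞} (hh : Measurable h) :
    Measurable (evalOutcome h) :=
  measurable_fun_sum hh measurable_const

lemma measurable_stoppedProcess_loopingTime (hφ : MeasurableSet φ) (n : ℕ) :
    Measurable (stoppedProcess (traceX (V := V)) (loopingTime φ) n) := by
  intro A hA
  have : stoppedProcess (traceX (V := V)) (loopingTime φ) n ⁻¹' A =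
      ⋃ t : WithTop ℕ, ({s | loopingTime φ s = t} ∩
        {s | s (min (n : WithTop ℕ) t).untopA ∈ A}) := by
    ext s
    simp [stoppedProcess, traceX]
  rw [this]
  have : Countable (WithTop ℕ) := inferInstanceAs (Countable (Option ℕ))
  exact MeasurableSet.iUnion fun t =>
    (measurable_loopingTime hφ t).inter (measurable_pi_apply _ hA)

/-- The stopped process reads off the trace at some time `m`, before which the trace has not left
the guard through a proper state. -/
lemma exists_stoppedProcess_loopingTime_eq (φ : Set (PState V)) (n : ℕ) (s : ℕ → Outcome V) :
    ∃ m, stoppedProcess traceX (loopingTime φ) n s = s m ∧ ∀ j < m, s j ∉ Sum.inl '' φᶜ := by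
  refine ⟨(min (n : WithTop ℕ) (loopingTime φ s)).untopA, rfl, fun j hj => ?_⟩
  have hne : min (n : WithTop ℕ) (loopingTime φ s) ≠ ⊤ :=
    ne_top_of_le_ne_top WithTop.coe_ne_top (min_le_left _ _)
  have hj' : (j : WithTop ℕ) < loopingTime φ s := by
    refine lt_of_lt_of_le ?_ (min_le_right (n : WithTop ℕ) _)
    rwa [WithTop.untopA_eq_untop hne, WithTop.lt_untop_iff] at hj
  exact notMem_of_lt_hittingAfter (u := traceX) hj' (Nat.zero_le j)

end Stopped

/-- A function dominating the stopped process when `b m` bounds the expectation after `m`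
iterations: the summand for `j` accounts for a loop that has survived up to time `j`, hence may run
for `j + 1` iterations. -/
noncomputable def survivalDominator {V : Type*} (φ : Set (PState V)) (b : ℕ → ℝ≥0∞)
    (s : ℕ → Outcome V) : ℝ≥0∞ :=
  b 0 + ∑' j, (survivalSet φ j).indicator (fun _ => b (j + 1)) s

section Dominator

variable {V : Type*} {φ : Set (PState V)}

lemma measurable_survivalDominator (hφ : MeasurableSet φ) (b : ℕ → ℝ≥0∞) :
    Measurable (survivalDominator φ b) :=
  measurable_const.add
    (Measurable.tsum fun j => measurable_const.indicator (measurableSet_survivalSet hφ j))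

lemma lintegral_survivalDominator (hφ : MeasurableSet φ) (b : ℕ → ℝ≥0∞)
    (P : Measure (ℕ → Outcome V)) [IsProbabilityMeasure P] :
    ∫⁻ s, survivalDominator φ b s ∂P = b 0 + ∑' j, b (j + 1) * P (survivalSet φ j) := by
  have hm : ∀ j, Measurable ((survivalSet φ j).indicator fun _ => b (j + 1)) := fun j =>
    measurable_const.indicator (measurableSet_survivalSet hφ j)
  simp only [survivalDominator]
  rw [lintegral_add_left measurable_const, lintegral_tsum fun j => (hm j).aemeasurable]
  simp [lintegral_indicator_const (measurableSet_survivalSet hφ _)]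

lemma le_survivalDominator {b : ℕ → ℝ≥0∞} {s : ℕ → Outcome V} {m : ℕ}
    (hs : ∀ j < m, s j ∈ Sum.inl '' φ) : b m ≤ survivalDominator φ b s := by
  cases m with
  | zero => exact le_self_add
  | succ m =>
    have hs' : s ∈ survivalSet φ m := fun j hj => hs j (by omega)
    refine le_trans ?_ le_add_self
    refine le_trans ?_ (ENNReal.le_tsum m)
    rw [Set.indicator_of_mem hs']

end Dominator

/-- If the stopped process is at the sink, its expectation is `0`; otherwise absorption of the sink
forces all earlier outcomes to be proper states, so the trace has survived and moved only linearly.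
-/
lemma evalOutcome_stoppedProcess_le {V : Type*} {φ : Set (PState V)} {c : ℝ≥0} {σ : PState V}
    {h : PState V → ℝ≥0∞} {b : ℕ → ℝ≥0∞}
    (hb : ∀ (n : ℕ) (τ : PState V), (∀ x, |τ x - σ x| ≤ c * n) → h τ ≤ b n)
    {s : ℕ → Outcome V} (h0 : s 0 = Sum.inl σ)
    (habs : ∀ n, s n = Sum.inr () → s (n + 1) = Sum.inr ())
    (hupd : ∀ n, UpdateBoundedBy c (s n) (s (n + 1))) (n : ℕ) :
    evalOutcome h (stoppedProcess traceX (loopingTime φ) n s) ≤ survivalDominator φ b s := by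
  obtain ⟨m, hm, hlt⟩ := exists_stoppedProcess_loopingTime_eq φ n s
  rw [hm]
  rcases hsm : s m with τ | u
  · have hproper : ∀ j < m, s j ∈ Set.range Sum.inl := by
      intro j hj
      rcases hsj : s j with ρ | u
      · exact ⟨ρ, rfl⟩
      · have : s m = Sum.inr () :=
          Nat.le_induction hsj (fun k _ hk => habs k hk) m hj.le
        simp [hsm] at this
    refine (hb m τ fun x => abs_sub_le_of_updateBoundedBy h0 hupd hproper hsm x).trans
      (le_survivalDominator fun j hj => ?_)
    obtain ⟨ρ, hρ⟩ := hproper j hj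
    refine ⟨ρ, ?_, hρ⟩
    by_contra hρφ
    exact hlt j hj ⟨ρ, hρφ, hρ⟩
  · exact zero_le

theorem mainTheorem6 {V : Type*} [Countable V]
    (φ : Set (PState V)) (hφ : MeasurableSet φ) (C : PGCL V)
    (hAST : ASTWitness φ C) (hupdate : BoundedUpdate C)
    (h : PState V → ℝ≥0∞) (hmeas : Measurable h) (hfin : ∀ σ, h σ < ∞)
    (hpoly : ∃ g : PState V → ℝ≥0∞,
      (IsPolynomialExpectation g ∨ IsPiecewisePolynomialExpectation g) ∧ ∀ σ, h σ ≤ g σ) :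
    UniformlyIntegrableFor φ C h := by
  intro σ
  obtain ⟨N, p, hp0, hp1, hp⟩ := hAST
  obtain ⟨c, hc⟩ := hupdate
  obtain ⟨g, hg, hhg⟩ := hpoly
  obtain ⟨K, d, hK, hgb⟩ :=
    (hg.elim (fun hg => hg.isPiecewisePolynomialExpectation) id).exists_le_of_linear_growth c σ
  set b : ℕ → ℝ≥0∞ := fun n => ENNReal.ofReal (K * (1 + n) ^ d) with hb
  have hprob : IsProbabilityMeasure (traceMeasure C σ) :=
    inferInstanceAs (IsProbabilityMeasure (C.sem.traceKernel σ))
  -- The period `N + 1` is positive even if `N = 0`.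
  have hsurv : ∀ j, traceMeasure C σ (survivalSet φ j) ≤ ENNReal.ofReal p ^ (j / (N + 1)) :=
    survivalSet_le_pow_div C.sem hφ (fun τ => (measure_mono
      ((survivalSet_anti φ N.le_succ).trans (survivalSet_subset_lt_loopingTime φ N))).trans
        (hp τ)) σ
  refine UniformlyIntegrableSeq.of_ae_le (F := survivalDominator φ b)
    (fun n => (measurable_evalOutcome hmeas).comp (measurable_stoppedProcess_loopingTime hφ n))
    (measurable_survivalDominator hφ b) ?_ fun n => ?_
  · rw [lintegral_survivalDominator hφ]
    refine ENNReal.add_ne_top.2 ⟨ENNReal.ofReal_ne_top, ?_⟩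
    refine ne_top_of_le_ne_top
      (summable_polynomial_mul_pow_div hp0 hp1 K d N).tsum_ofReal_ne_top
      (ENNReal.tsum_le_tsum fun j => ?_)
    rw [ENNReal.ofReal_mul (by positivity), ENNReal.ofReal_pow hp0.le]
    exact mul_le_mul_right (hsurv j) _
  · filter_upwards [C.sem.ae_traceKernel_zero σ, C.sem.ae_traceKernel_absorbing σ, hc σ]
      with s h0 habs hupd
    exact evalOutcome_stoppedProcess_le (fun m τ hτ => (hhg τ).trans (hgb m τ hτ)) h0 habs hupd n
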